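/- A Gelfand–Tsetlin triangle of size $n$ is an array $X=(X_{i,j})_{n\ge i\ge j\ge 1}$ of positive integers with $X_{i+1,j}\le X_{i,j}\le X_{i+1,j+1}$ for $n-1\ge i\ge j\ge 1$. It is a *Gog triangle* if $X_{i,j}<X_{i,j+1}$ for $1\le j<i\le n-1$ and $X_{n,j}=j$ for $1\le j\le n$; it is a *Magog triangle* if $X_{j,j}\le j$ for $1\le j\le n$; it is a *GOGAm triangle* if its image under the Schützenberger involution $S$ is a Magog triangle. Here $S=\omega_1\omega_2\cdots\omega_{n-1}$, $\omega_j=s_js_{j-1}\cdots s_1$, and $s_k$ changes only row $k$, replacing $X_{k,j}$ by $\max(X_{k+1,j},X_{k-1,j-1})+\min(X_{k+1,j+1},X_{k-1,j})-X_{k,j}$, where entries that do not exist are omitted from the maximum or minimum. For $n\ge k,l,m$, an $(n,k,l,m)$ Gog (resp. GOGAm) pentagon is the array of the entries $X_{i,j}$ with $j\le k$, $i-j\le l-1$, $i\le m$ of some Gog (resp. GOGAm) triangle $X$ of size $n$. An *inversion* of a triangle $X$ of size $N$ is a pair $(i,j)$, $1\le j\le i\le N-1$, with $X_{i,j}=X_{i+1,j}$;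 it covers the positions $(i+p,j+p)$, $1\le p\le N-i$. The *standard procedure* goes through the inversions $(i,j)$ of $X$ in the order of decreasing $j$ and, for equal $j$, of decreasing $i$, and for each of them subtracts $1$ from all entries it covers; $X$ is *admissible* if all the successive arrays so obtained are Gelfand–Tsetlin triangles. Let $n\ge 3$. Write a size-$3$ triangle as $(a,d,f\,|\,b,e\,|\,c)$, with $a=X_{3,1}$, $d=X_{3,2}$, $f=X_{3,3}$, $b=X_{2,1}$, $e=X_{2,2}$, $c=X_{1,1}$. 1. The $(n,3,3,3)$ Gog pentagons are exactly the Gelfand–Tsetlin triangles of size $3$ with $a<d<f$, $b<e$, $f\le n$. 2. The $(n,3,3,3)$ GOGAm pentagons are exactly the Gelfand–Tsetlin triangles of size $3$ with $f\le n$, $f-e+d\le n-1$, $f-c+b\le n-1$, $f-e+d-b+a\le n-2$. 3. The following table, which lists the $(n,3,3,3)$ Gog pentagons by their set of inversions, defines a bijection from the $(n,3,3,3)$ Gog pentagons onto the $(n,3,3,3)$ GOGAm pentagons: | inversions | Gog | GOGAm | |---|---|---| | none | $(a,d,f\,\vert\,b,e\,\vert\,c)$ | $(a,d,f\,\vert\,b,e\,\vert\,c)$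 | | $(2,2)$ | $(a,d,f\,\vert\,b,d\,\vert\,c)$ | $(a,d,f-1\,\vert\,b,d\,\vert\,c)$ | | $(2,1)$ | $(a,d,f\,\vert\,a,e\,\vert\,c)$ | $(a,d-1,f\,\vert\,a,e\,\vert\,c)$ | | $(1,1)$ | $(a,d,f\,\vert\,b,e\,\vert\,b)$ | $(a,d,f-1\,\vert\,b,e-1\,\vert\,b)$ | | $(1,1),(2,2)$ | $(a,d,f\,\vert\,b,d\,\vert\,b)$ | $(a,d-1,f-2\,\vert\,a,d-1\,\vert\,b)$ | | $(2,1),(2,2)$ | $(a,d,f\,\vert\,a,d\,\vert\,c)$ | $(a,d-1,f-1\,\vert\,a,d\,\vert\,c)$ | | $(2,1),(1,1)$ | $(a,d,f\,\vert\,a,e\,\vert\,a)$ | $(a,d-1,f-1\,\vert\,a,e-1\,\vert\,a)$ | | all three | $(a,d,f\,\vert\,a,d\,\vert\,a)$ | $(a,d-1,f-2\,\vert\,a,d-1\,\vert\,a)$ | 4. A Gog pentagon whose set of inversions is not $\{(1,1),(2,2)\}$ is admissible (as a triangle of size $3$), and its image in the table is the result of the standard procedure. A Gog pentagon whose set of inversions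 is $\{(1,1),(2,2)\}$ is not admissible. 5. Consequently, the sets of $(n,3,3,3)$ Gog pentagons and of $(n,3,3,3)$ GOGAm pentagons are finite and have the same number of elements. -/

import Mathlib

namespace Pentagons

/-- Arrays `(X_{i,j})` of integers. An array indexed by a finite set of positions is represented by
the function that has the given entries and is `0` at all other positions. -/
abbrev IntArray := ℕ → ℕ → ℤ

/-- Gelfand-Tsetlin triangles of size `n`: triangular arrays `(X_{i,j})`, `n ≥ i ≥ j ≥ 1`, of
positive integers (row `n`, the longest one, is drawn on top) with the interlacing inequalities. -/
def IsGelfandTsetlin (n : ℕ) (X : IntArray) : Prop :=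
  (∀ i j, 1 ≤ j → j ≤ i → i ≤ n → 0 < X i j) ∧
  (∀ i j, ¬ (1 ≤ j ∧ j ≤ i ∧ i ≤ n) → X i j = 0) ∧
  (∀ i j, 1 ≤ j → j ≤ i → i + 1 ≤ n → X (i + 1) j ≤ X i j ∧ X i j ≤ X (i + 1) (j + 1))

/-- The operation `s_k`: every entry of row `k` is reflected in the centre of the smallest interval
cut out by its neighbours in rows `k + 1` and `k - 1`. Of the latter, `X_{k-1,j-1}` is missing for
`j = 1` and `X_{k-1,j}` is missing for `j = k`. -/
def rowReflection (k : ℕ) (X : IntArray) : IntArray := fun i j =>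
  if i = k ∧ 1 ≤ j ∧ j ≤ k then
    (if 1 < j then max (X (k + 1) j) (X (k - 1) (j - 1)) else X (k + 1) j)
      + (if j < k then min (X (k + 1) (j + 1)) (X (k - 1) j) else X (k + 1) (j + 1))
      - X k j
  else X i j

/-- `ω_j = s_j s_{j-1} ⋯ s_1` (composition of maps, so `s_1` is applied first). -/
def omegaOp : ℕ → IntArray → IntArray
  | 0 => id
  | j + 1 => rowReflection (j + 1) ∘ omegaOp j

/-- `ω_1 ω_2 ⋯ ω_m` (composition of maps). -/
def omegaProd : ℕ → IntArray → IntArray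
  | 0 => id
  | m + 1 => omegaProd m ∘ omegaOp (m + 1)

/-- The Schützenberger involution `S = ω_1 ω_2 ⋯ ω_{n-1}` on Gelfand-Tsetlin triangles of
size `n`. -/
def schutzenberger (n : ℕ) : IntArray → IntArray := omegaProd (n - 1)

def IsGog (n : ℕ) (X : IntArray) : Prop :=
  IsGelfandTsetlin n X ∧
  (∀ i j, 1 ≤ j → j < i → i < n → X i j < X i (j + 1)) ∧
  (∀ j, 1 ≤ j → j ≤ n → X n j = (j : ℤ))

def IsMagog (n : ℕ) (X : IntArray) : Prop :=
  IsGelfandTsetlin n X ∧ ∀ j, 1 ≤ j → j ≤ n → X j j ≤ (j : ℤ)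

def IsGOGAm (n : ℕ) (X : IntArray) : Prop :=
  IsGelfandTsetlin n X ∧ IsMagog n (schutzenberger n X)

/-- The part of a triangle of size `n` in the `k` leftmost NW-SE diagonals (`j ≤ k`), the `l`
rightmost SW-NE diagonals (`i - j ≤ l - 1`) and the `m` bottom rows (`i ≤ m`). -/
def pentagonPart (n k l m : ℕ) (X : IntArray) : IntArray := fun i j =>
  if (1 ≤ j ∧ j ≤ i ∧ i ≤ n) ∧ j ≤ k ∧ i + 1 ≤ j + l ∧ i ≤ m then X i j else 0

/-- The set of `(n,k,l,m)` Gog pentagons (for `n ≥ k, l, m`). -/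
def gogPentagons (n k l m : ℕ) : Set IntArray :=
  {P | ∃ X, IsGog n X ∧ pentagonPart n k l m X = P}

/-- The set of `(n,k,l,m)` GOGAm pentagons (for `n ≥ k, l, m`). -/
def gogamPentagons (n k l m : ℕ) : Set IntArray :=
  {P | ∃ X, IsGOGAm n X ∧ pentagonPart n k l m X = P}

/-- `(i,j)` is an inversion of the triangle `X` of size `n`. -/
def IsInversion (n : ℕ) (X : IntArray) (i j : ℕ) : Prop :=
  (1 ≤ j ∧ j ≤ i ∧ i + 1 ≤ n) ∧ X i j = X (i + 1) j

instance (n : ℕ) (X : IntArray) (i j : ℕ) : Decidable (IsInversion n X i j) :=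
  inferInstanceAs (Decidable ((1 ≤ j ∧ j ≤ i ∧ i + 1 ≤ n) ∧ X i j = X (i + 1) j))

/-- The position `q` (in a triangle of size `n`) is covered by an inversion at position `p`. -/
def Covers (n : ℕ) (p q : ℕ × ℕ) : Prop :=
  ∃ t : ℕ, 1 ≤ t ∧ p.1 + t ≤ n ∧ q = (p.1 + t, p.2 + t)

open Classical in
/-- Subtract `1` from all entries covered by the inversion at position `p`. -/
noncomputable def subtractCovered (n : ℕ) (X : IntArray) (p : ℕ × ℕ) : IntArray := fun i j =>
  if Covers n p (i, j) then X i j - 1 else X i j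

/-- The inversions of a triangle of size `n`, listed along the successive NW-SE diagonals
(`j` constant), starting from the rightmost one (largest `j`), and along each diagonal from NW to SE
(decreasing `i`). -/
def inversionList (n : ℕ) (X : IntArray) : List (ℕ × ℕ) :=
  ((List.range n).reverse.flatMap fun j => (List.range n).reverse.map fun i => (i, j)).filter
    fun p => decide (IsInversion n X p.1 p.2)

/-- The result of the standard procedure: for each inversion of `X`, in the order of
`inversionList`, subtract `1` from the entries that it covers. -/
noncomputable def standardProcedure (n : ℕ) (X : IntArray) : IntArray :=
  (inversionList n X).foldl (subtractCovered n) X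

/-- `X` is admissible: all the successive arrays of the standard procedure are Gelfand-Tsetlin
triangles. -/
def Admissible (n : ℕ) (X : IntArray) : Prop :=
  ∀ Y ∈ (inversionList n X).scanl (subtractCovered n) X, IsGelfandTsetlin n Y

/-- The size 3 triangle with rows, from top to bottom, `(a, d, f)`, `(b, e)`, `(c)`. -/
def triangle3 (a d f b e c : ℤ) : IntArray
  | 3, 1 => a
  | 3, 2 => d
  | 3, 3 => f
  | 2, 1 => b
  | 2, 2 => e
  | 1, 1 => c
  | _, _ => 0

/-- The explicit table. With the entries of `X` named as in `triangle3`, the three Booleans say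
whether `(2,1)` (`b = a`), `(2,2)` (`e = d`) and `(1,1)` (`c = b`) are inversions. -/
def pentagonTable (X : IntArray) : IntArray :=
  let a := X 3 1
  let d := X 3 2
  let f := X 3 3
  let b := X 2 1
  let e := X 2 2
  let c := X 1 1
  match decide (IsInversion 3 X 2 1), decide (IsInversion 3 X 2 2),
      decide (IsInversion 3 X 1 1) with
  | false, false, false => triangle3 a d f b e c
  | false, true, false => triangle3 a d (f - 1) b d c
  | true, false, false => triangle3 a (d - 1) f a e c
  | false, false, true => triangle3 a d (f - 1) b (e - 1) b
  | false, true, true => triangle3 a (d - 1) (f - 2) a (d - 1) b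
  | true, true, false => triangle3 a (d - 1) (f - 1) a d c
  | true, false, true => triangle3 a (d - 1) (f - 1) a (e - 1) a
  | true, true, true => triangle3 a (d - 1) (f - 2) a (d - 1) a

end Pentagons

open Pentagons

/-!
An `(n,m,m,m)` pentagon consists of the `m` bottom rows of a triangle of size `n`, so the task is to
decide which triangles of size `m` extend to Gog or GOGAm triangles of size `n`.

A Gog triangle has strictly increasing rows, and its largest entry is `n`. Conversely a triangle
with these properties is extended upwards by `X_{i,j} = max(j, X_{i-1,j-1})`.

The row `i` of `ω_k X` does not depend on `k ≥ i`; it is the row `i` of an array `∂X` that is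
determined by the rows `≤ i + 1` of `X`, and the row `n - t` of `S X` is the row `n - t` of `∂^t X`.
As the entries `X_{i,i}` of a Gelfand-Tsetlin triangle increase with `i`, the entry `(n-t,n-t)`
of `S X` is at least the entry `(m-t,m-t)` of the Schützenberger involution of the `m` bottom rows.
Equality holds when every row above row `m` is the preceding one with a `1` put in front, because
then `∂X` has this property above row `m - 1`. Hence a triangle `X` of size `m` is a GOGAm pentagon
if and only if `(S X)_{j,j} ≤ j + (n - m)` for all `j`. For `m = 3` the three entries `(S X)_{j,j}`
are `f`, `max(f-e+d, f-c+b)` and `f-e+d-b+a`.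
-/

namespace Pentagons

/-! ### Interlacing rows -/

/-- The interlacing inequalities between the rows `1, …, n` of an array. In contrast to
`IsGelfandTsetlin n X`, nothing is said about the other rows of `X`. -/
def IsInterlacing (n : ℕ) (X : IntArray) : Prop :=
  ∀ i j, 1 ≤ j → j ≤ i → i + 1 ≤ n → X (i + 1) j ≤ X i j ∧ X i j ≤ X (i + 1) (j + 1)

section Interlacing

variable {n : ℕ} {X : IntArray}

lemma IsGelfandTsetlin.isInterlacing (hX : IsGelfandTsetlin n X) : IsInterlacing n X :=
  hX.2.2

lemma IsInterlacing.apply_le_apply_of_row_le (hX : IsInterlacing n X) {i k j : ℕ} (h1 : 1 ≤ j)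
    (hji : j ≤ i) (hik : i ≤ k) (hk : k ≤ n) : X k j ≤ X i j := by
  induction k, hik using Nat.le_induction with
  | base => exact le_rfl
  | succ k hik ih => exact (hX k j h1 (hji.trans hik) hk).1.trans (ih (by omega))

lemma IsInterlacing.diag_le_diag (hX : IsInterlacing n X) {i k : ℕ} (h1 : 1 ≤ i) (hik : i ≤ k)
    (hk : k ≤ n) : X i i ≤ X k k := by
  induction k, hik using Nat.le_induction with
  | base => exact le_rfl
  | succ k hik ih => exact (ih (by omega)).trans (hX k k (h1.trans hik) le_rfl hk).2

lemma IsInterlacing.row_monotone (hX : IsInterlacing n X) {i j : ℕ} (h1 : 1 ≤ j) (hji : j < i)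
    (hi : i ≤ n) : X i j ≤ X i (j + 1) := by
  obtain ⟨i, rfl⟩ := Nat.exists_eq_add_of_le' (h1.trans hji.le)
  obtain ⟨hle, hge⟩ := hX i j h1 (by omega) hi
  exact hle.trans hge

lemma IsInterlacing.apply_le_diag (hX : IsInterlacing n X) {i j : ℕ} (h1 : 1 ≤ j) (hji : j ≤ i)
    (hi : i ≤ n) : X i j ≤ X n n := by
  refine le_trans ?_ (hX.diag_le_diag (h1.trans hji) hi le_rfl)
  induction hji using Nat.decreasingInduction with
  | self => exact le_rfl
  | of_succ j hji ih => exact (hX.row_monotone h1 hji hi).trans (ih (by omega))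

end Interlacing

lemma finite_setOf_isGelfandTsetlin (n : ℕ) (N : ℤ) :
    {X | IsGelfandTsetlin n X ∧ X n n ≤ N}.Finite := by
  let entries (X : IntArray) : Fin (n + 1) → Fin (n + 1) → ℤ := fun i j => X i j
  have hbox : (Set.univ.pi fun _ => Set.univ.pi fun _ => Set.Icc 0 (max 0 N) :
      Set (Fin (n + 1) → Fin (n + 1) → ℤ)).Finite :=
    Set.Finite.pi fun _ => Set.Finite.pi fun _ => Set.finite_Icc 0 (max 0 N)
  refine hbox.of_injOn (f := entries) ?_ ?_
  · rintro X ⟨hX, hN⟩ i - j -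
    by_cases hij : 1 ≤ (j : ℕ) ∧ (j : ℕ) ≤ i
    · have hi : (i : ℕ) ≤ n := Nat.le_of_lt_succ i.2
      exact ⟨(hX.1 i j hij.1 hij.2 hi).le,
        le_max_of_le_right ((hX.isInterlacing.apply_le_diag hij.1 hij.2 hi).trans hN)⟩
    · have hzero : X i j = 0 := hX.2.1 i j fun h => hij ⟨h.1, h.2.1⟩
      exact ⟨hzero.ge, hzero.le.trans (le_max_left 0 N)⟩
  · rintro X ⟨hX, -⟩ Y ⟨hY, -⟩ hXY
    funext i j
    by_cases hij : 1 ≤ j ∧ j ≤ i ∧ i ≤ n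
    · exact congr_fun₂ hXY ⟨i, by omega⟩ ⟨j, by omega⟩
    · rw [hX.2.1 i j hij, hY.2.1 i j hij]

lemma finite_gogPentagons (n k l m : ℕ) : (gogPentagons n k l m).Finite := by
  refine ((finite_setOf_isGelfandTsetlin n n).image (pentagonPart n k l m)).subset ?_
  rintro _ ⟨X, ⟨hX, -, htop⟩, rfl⟩
  refine ⟨X, ⟨hX, ?_⟩, rfl⟩
  rcases n.eq_zero_or_pos with rfl | hn
  · exact (hX.2.1 0 0 (by omega)).le
  · exact (htop n hn le_rfl).le

/-! ### Restriction to the bottom rows, and extensions -/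

section Extension

variable {m n : ℕ} {X : IntArray} {g : ℕ → ℤ}

lemma pentagonPart_apply (hmn : m ≤ n) (X : IntArray) (i j : ℕ) :
    pentagonPart n m m m X i j = if 1 ≤ j ∧ j ≤ i ∧ i ≤ m then X i j else 0 :=
  if_congr (by omega) rfl rfl

lemma pentagonPart_apply_of_le (hmn : m ≤ n) {i j : ℕ} (h1 : 1 ≤ j) (hji : j ≤ i) (hi : i ≤ m) :
    pentagonPart n m m m X i j = X i j := by
  rw [pentagonPart_apply hmn, if_pos ⟨h1, hji, hi⟩]

lemma IsGelfandTsetlin.pentagonPart_row (hX : IsGelfandTsetlin n X) (hmn : m ≤ n) {i : ℕ}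
    (hi : i ≤ m) : pentagonPart n m m m X i = X i := by
  funext j
  by_cases hj : 1 ≤ j ∧ j ≤ i
  · exact pentagonPart_apply_of_le hmn hj.1 hj.2 hi
  · rw [pentagonPart_apply hmn, if_neg (by omega), hX.2.1 i j (by omega)]

protected lemma IsGelfandTsetlin.pentagonPart (hX : IsGelfandTsetlin n X) (hmn : m ≤ n) :
    IsGelfandTsetlin m (pentagonPart n m m m X) := by
  refine ⟨fun i j h1 hji hi => ?_, fun i j hij => ?_, fun i j h1 hji hi => ?_⟩
  · rw [hX.pentagonPart_row hmn hi]
    exact hX.1 i j h1 hji (hi.trans hmn)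
  · rw [pentagonPart_apply hmn, if_neg hij]
  · rw [hX.pentagonPart_row hmn hi, hX.pentagonPart_row hmn (by omega)]
    exact hX.2.2 i j h1 hji (hi.trans hmn)

/-- The smallest extension of a triangle `X` of size `m` to a triangle of size `n` whose entries
`(i,j)` are all at least `g j`. Above row `m` it is `max (g j) (X_{m,j-(i-m)})`; the truncated
subtraction gives the entry `X_{m,0} = 0` where `X_{m,j-(i-m)}` does not exist. -/
def extension (n m : ℕ) (g : ℕ → ℤ) (X : IntArray) : IntArray := fun i j =>
  if 1 ≤ j ∧ j ≤ i ∧ i ≤ n then max (g j) (X (min i m) (j - (i - m))) else 0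

lemma extension_apply {i j : ℕ} (h1 : 1 ≤ j) (hji : j ≤ i) (hi : i ≤ n) :
    extension n m g X i j = max (g j) (X (min i m) (j - (i - m))) :=
  if_pos ⟨h1, hji, hi⟩

lemma IsGelfandTsetlin.pentagonPart_extension (hX : IsGelfandTsetlin m X) (hmn : m ≤ n)
    (hg : ∀ i j, 1 ≤ j → j ≤ i → i ≤ m → g j ≤ X i j) :
    pentagonPart n m m m (extension n m g X) = X := by
  funext i j
  by_cases hij : 1 ≤ j ∧ j ≤ i ∧ i ≤ m
  · obtain ⟨h1, hji, hi⟩ := hij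
    rw [pentagonPart_apply_of_le hmn h1 hji hi, extension_apply h1 hji (hi.trans hmn),
      min_eq_left hi, Nat.sub_eq_zero_of_le hi, Nat.sub_zero, max_eq_right (hg i j h1 hji hi)]
  · rw [pentagonPart_apply hmn, if_neg hij, hX.2.1 i j hij]

protected lemma IsGelfandTsetlin.extension (hX : IsGelfandTsetlin m X) (hpos : ∀ j, 1 ≤ j → 0 < g j)
    (hmono : Monotone g) : IsGelfandTsetlin n (extension n m g X) := by
  refine ⟨fun i j h1 hji hi => ?_, fun i j hij => if_neg hij, fun i j h1 hji hi => ?_⟩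
  · rw [extension_apply h1 hji hi]
    exact lt_max_of_lt_left (hpos j h1)
  · rw [extension_apply h1 (by omega) hi, extension_apply h1 hji (by omega),
      extension_apply (by omega) (by omega) hi]
    rcases Nat.lt_or_ge i m with him | him
    · obtain ⟨hle, hge⟩ := hX.2.2 i j h1 hji him
      rw [min_eq_left him, min_eq_left him.le, Nat.sub_eq_zero_of_le him,
        Nat.sub_eq_zero_of_le him.le]
      exact ⟨max_le_max le_rfl hle, max_le_max (hmono j.le_succ) hge⟩
    · rw [min_eq_right him, min_eq_right (him.trans i.le_succ),
        show j + 1 - (i + 1 - m) = j - (i - m) by omega]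
      refine ⟨max_le_max le_rfl ?_, max_le_max (hmono j.le_succ) le_rfl⟩
      rcases Nat.lt_or_ge (i - m) j with hij | hij
      · obtain ⟨k, hk⟩ : ∃ k, j - (i - m) = k + 1 := ⟨j - (i - m) - 1, by omega⟩
        rw [hk, show j - (i + 1 - m) = k by omega]
        rcases k.eq_zero_or_pos with rfl | hk0
        · rw [hX.2.1 m 0 (by omega)]
          exact (hX.1 m 1 le_rfl (by omega) le_rfl).le
        · exact hX.isInterlacing.row_monotone hk0 (by omega) le_rfl
      · rw [show j - (i + 1 - m) = 0 by omega, show j - (i - m) = 0 by omega]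

end Extension

/-! ### Gog pentagons -/

/-- Monotone triangles of size `n`: Gelfand-Tsetlin triangles with strictly increasing rows. In
contrast to a Gog triangle, the row `n` need not be `(1, …, n)`. -/
def IsMonotoneTriangle (n : ℕ) (X : IntArray) : Prop :=
  IsGelfandTsetlin n X ∧ ∀ i j, 1 ≤ j → j < i → i ≤ n → X i j < X i (j + 1)

section Gog

variable {m n : ℕ} {X : IntArray}

lemma IsMonotoneTriangle.apply_add_sub_le (hX : IsMonotoneTriangle n X) {i j k : ℕ} (h1 : 1 ≤ j)
    (hjk : j ≤ k) (hki : k ≤ i) (hi : i ≤ n) : X i j + (k - j) ≤ X i k := by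
  induction k, hjk using Nat.le_induction with
  | base => simp only [sub_self, add_zero, le_rfl]
  | succ k hjk ih =>
    have hlt := hX.2 i k (h1.trans hjk) hki hi
    have hle := ih (by omega)
    push_cast
    omega

lemma IsMonotoneTriangle.le_apply (hX : IsMonotoneTriangle n X) {i j : ℕ} (h1 : 1 ≤ j)
    (hji : j ≤ i) (hi : i ≤ n) : (j : ℤ) ≤ X i j := by
  have hpos := hX.1.1 i 1 le_rfl (h1.trans hji) hi
  have hle := hX.apply_add_sub_le le_rfl h1 hji hi
  push_cast at hle
  omega

lemma IsMonotoneTriangle.isGog_extension (hX : IsMonotoneTriangle m X) (hmn : m ≤ n)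
    (hle : X m m ≤ n) : IsGog n (extension n m (fun j => j) X) := by
  refine ⟨hX.1.extension (fun j h1 => by omega) Nat.mono_cast, fun i j h1 hji hi => ?_,
    fun j h1 hj => ?_⟩
  · rw [extension_apply h1 hji.le hi.le, extension_apply (by omega) hji hi.le]
    push_cast
    rcases Nat.lt_or_ge (i - m) j with hij | hij
    · have hlt := hX.2 (min i m) (j - (i - m)) (by omega) (by omega) (by omega)
      rw [show j + 1 - (i - m) = j - (i - m) + 1 by omega]
      exact max_lt_max (by omega) hlt
    · rw [show j - (i - m) = 0 by omega, hX.1.2.1 (min i m) 0 (by omega)]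
      exact lt_max_of_lt_left (by omega)
  · rw [extension_apply h1 hj le_rfl, min_eq_right hmn, max_eq_left]
    rcases Nat.lt_or_ge (n - m) j with hnj | hnj
    · have := hX.apply_add_sub_le (i := m) (j := j - (n - m)) (k := m) (by omega) (by omega)
        le_rfl le_rfl
      omega
    · rw [show j - (n - m) = 0 by omega, hX.1.2.1 m 0 (by omega)]
      exact Int.natCast_nonneg j

lemma IsGog.isMonotoneTriangle (hX : IsGog n X) : IsMonotoneTriangle n X := by
  obtain ⟨hGT, hlt, htop⟩ := hX
  refine ⟨hGT, fun i j h1 hji hi => ?_⟩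
  rcases hi.lt_or_eq with hi | rfl
  · exact hlt i j h1 hji hi
  · rw [htop j h1 hji.le, htop (j + 1) (by omega) hji]
    omega

protected lemma IsMonotoneTriangle.pentagonPart (hX : IsMonotoneTriangle n X) (hmn : m ≤ n) :
    IsMonotoneTriangle m (pentagonPart n m m m X) := by
  refine ⟨hX.1.pentagonPart hmn, fun i j h1 hji hi => ?_⟩
  rw [hX.1.pentagonPart_row hmn hi]
  exact hX.2 i j h1 hji (hi.trans hmn)

theorem mem_gogPentagons_iff (hm : 1 ≤ m) (hmn : m ≤ n) :
    X ∈ gogPentagons n m m m ↔ IsMonotoneTriangle m X ∧ X m m ≤ n := by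
  constructor
  · rintro ⟨Y, hY, rfl⟩
    refine ⟨hY.isMonotoneTriangle.pentagonPart hmn, ?_⟩
    rw [hY.1.pentagonPart_row hmn le_rfl, ← hY.2.2 n (hm.trans hmn) le_rfl]
    exact hY.1.isInterlacing.diag_le_diag hm hmn le_rfl
  · rintro ⟨hX, hle⟩
    exact ⟨_, hX.isGog_extension hmn hle,
      hX.1.pentagonPart_extension hmn fun i j h1 hji hi => hX.le_apply h1 hji hi⟩

end Gog

/-! ### The Schützenberger involution by rows -/

section Promotion

variable {n : ℕ} {X Y : IntArray}

lemma rowReflection_of_ne {k i : ℕ} (hik : i ≠ k) (X : IntArray) : rowReflection k X i = X i := by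
  funext j
  exact if_neg fun h => hik h.1

lemma omegaOp_of_lt {k i : ℕ} (hki : k < i) (X : IntArray) : omegaOp k X i = X i := by
  induction k with
  | zero => rfl
  | succ k ih =>
    rw [omegaOp, Function.comp_apply, rowReflection_of_ne hki.ne', ih (by omega)]

/-- The promotion `∂`, the common value of all `ω_k` with `k ≥ i` in row `i`. -/
def promotion (X : IntArray) : IntArray := fun i => omegaOp i X i

lemma omegaOp_of_le {k i : ℕ} (hik : i ≤ k) (X : IntArray) : omegaOp k X i = promotion X i := by
  induction k, hik using Nat.le_induction with
  | base => rfl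
  | succ k hik ih =>
    rw [omegaOp, Function.comp_apply, rowReflection_of_ne (by omega), ih]

lemma promotion_succ (X : IntArray) (i j : ℕ) :
    promotion X (i + 1) j =
      if 1 ≤ j ∧ j ≤ i + 1 then
        (if 1 < j then max (X (i + 1 + 1) j) (promotion X i (j - 1)) else X (i + 1 + 1) j)
          + (if j < i + 1 then min (X (i + 1 + 1) (j + 1)) (promotion X i j)
              else X (i + 1 + 1) (j + 1))
          - X (i + 1) j
      else X (i + 1) j := by
  simp only [promotion, omegaOp, Function.comp_apply, rowReflection, Nat.add_sub_cancel, true_and,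
    omegaOp_of_lt (show i < i + 1 + 1 by omega), omegaOp_of_lt (Nat.lt_succ_self i)]

lemma promotion_of_outside {i j : ℕ} (hij : ¬(1 ≤ j ∧ j ≤ i)) (X : IntArray) :
    promotion X i j = X i j := by
  cases i with
  | zero => rfl
  | succ i => rw [promotion_succ, if_neg hij]

lemma iterate_promotion_of_outside {i j : ℕ} (hij : ¬(1 ≤ j ∧ j ≤ i)) (t : ℕ) (X : IntArray) :
    promotion^[t] X i j = X i j := by
  induction t generalizing X with
  | zero => rfl
  | succ t ih => rw [Function.iterate_succ_apply, ih, promotion_of_outside hij]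

lemma promotion_congr {i : ℕ} (hXY : ∀ k ≤ i + 1, X k = Y k) : promotion X i = promotion Y i := by
  induction i with
  | zero => exact hXY 0 (by omega)
  | succ i ih =>
    funext j
    simp only [promotion_succ, hXY (i + 1 + 1) le_rfl, hXY (i + 1) (by omega),
      ih fun k hk => hXY k (by omega)]

lemma iterate_promotion_congr {t i : ℕ} (hXY : ∀ k ≤ i + t, X k = Y k) :
    promotion^[t] X i = promotion^[t] Y i := by
  induction t generalizing X Y with
  | zero => exact hXY i le_rfl
  | succ t ih =>
    simp only [Function.iterate_succ_apply]
    exact ih fun k hk => promotion_congr fun l hl => hXY l (by omega)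

lemma schutzenberger_succ (n : ℕ) (X : IntArray) :
    schutzenberger (n + 1) X = schutzenberger n (omegaOp n X) := by
  cases n <;> rfl

lemma schutzenberger_of_le {i : ℕ} (hni : n ≤ i) (X : IntArray) : schutzenberger n X i = X i := by
  induction n generalizing X with
  | zero => rfl
  | succ n ih => rw [schutzenberger_succ, ih (by omega), omegaOp_of_lt hni]

lemma schutzenberger_row (i t : ℕ) (X : IntArray) :
    schutzenberger (i + t) X i = promotion^[t] X i := by
  induction t generalizing X with
  | zero => exact schutzenberger_of_le le_rfl X
  | succ t ih =>
    rw [← add_assoc, schutzenberger_succ, ih, Function.iterate_succ_apply]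
    exact iterate_promotion_congr fun k hk => omegaOp_of_le hk X

lemma schutzenberger_congr (hXY : ∀ k ≤ n, X k = Y k) {i : ℕ} (hi : i ≤ n) :
    schutzenberger n X i = schutzenberger n Y i := by
  obtain ⟨t, rfl⟩ := Nat.exists_eq_add_of_le hi
  rw [schutzenberger_row, schutzenberger_row, iterate_promotion_congr hXY]

lemma schutzenberger_of_outside {i j : ℕ} (hij : ¬(1 ≤ j ∧ j ≤ i ∧ i ≤ n)) (X : IntArray) :
    schutzenberger n X i j = X i j := by
  rcases le_total n i with hni | hin
  · rw [schutzenberger_of_le hni]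
  · obtain ⟨t, rfl⟩ := Nat.exists_eq_add_of_le hin
    rw [schutzenberger_row, iterate_promotion_of_outside (by omega)]

/-- Reflecting a point of an interval in the centre of the interval does not leave the interval. -/
lemma IsInterlacing.promotion_bounds (hX : IsInterlacing n X) {i j : ℕ} (h1 : 1 ≤ j) (hji : j ≤ i)
    (hi : i + 1 ≤ n) :
    (X (i + 1) j ≤ promotion X i j ∧ promotion X i j ≤ X (i + 1) (j + 1)) ∧
      (1 < j → promotion X (i - 1) (j - 1) ≤ promotion X i j) ∧
      (j < i → promotion X i j ≤ promotion X (i - 1) j) := by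
  induction i generalizing j with
  | zero => omega
  | succ i ih =>
    have hupper := hX (i + 1) j h1 hji hi
    have hleft (hj : 1 < j) : promotion X i (j - 1) ≤ X (i + 1) j := by
      have := (ih (j := j - 1) (by omega) (by omega) (by omega)).1.2
      rwa [Nat.sub_add_cancel h1] at this
    have hright (hj : j < i + 1) : X (i + 1) j ≤ promotion X i j :=
      (ih h1 (by omega) (by omega)).1.1
    rw [promotion_succ, if_pos ⟨h1, hji⟩, Nat.add_sub_cancel]
    split_ifs <;> omega

protected lemma IsInterlacing.promotion (hX : IsInterlacing (n + 1) X) :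
    IsInterlacing n (promotion X) := by
  intro i j h1 hji hi
  have hle := (hX.promotion_bounds h1 (by omega : j ≤ i + 1) (by omega)).2.2 (by omega)
  have hge := (hX.promotion_bounds (by omega) (by omega : j + 1 ≤ i + 1) (by omega)).2.1 (by omega)
  exact ⟨hle, hge⟩

lemma IsInterlacing.iterate_promotion {t : ℕ} (hX : IsInterlacing (n + t) X) :
    IsInterlacing n (promotion^[t] X) := by
  induction t generalizing X with
  | zero => exact hX
  | succ t ih => exact ih hX.promotion

protected lemma IsInterlacing.schutzenberger (hX : IsInterlacing n X) :
    IsInterlacing n (schutzenberger n X) := by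
  intro i j h1 hji hi
  obtain ⟨t, rfl⟩ := Nat.exists_eq_add_of_le hi
  rw [schutzenberger_row, show i + 1 + t = i + (t + 1) by omega, schutzenberger_row,
    Function.iterate_succ_apply']
  exact (hX.iterate_promotion.promotion_bounds h1 hji le_rfl).1

protected lemma IsGelfandTsetlin.schutzenberger (hX : IsGelfandTsetlin n X) :
    IsGelfandTsetlin n (schutzenberger n X) := by
  have hS := hX.isInterlacing.schutzenberger
  refine ⟨fun i j h1 hji hi => ?_, fun i j hij => ?_, hS⟩
  · have htop := hX.1 n j h1 (hji.trans hi) le_rfl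
    rw [← schutzenberger_of_le le_rfl X] at htop
    exact htop.trans_le (hS.apply_le_apply_of_row_le h1 hji hi le_rfl)
  · rw [schutzenberger_of_outside hij, hX.2.1 i j hij]

lemma IsInterlacing.schutzenberger_diag_le {m t j : ℕ} (hX : IsInterlacing n X) (hmn : m ≤ n)
    (h1 : 1 ≤ j) (hj : j + t = m) :
    schutzenberger m X j j ≤ schutzenberger n X (n - t) (n - t) := by
  obtain ⟨k, rfl⟩ : ∃ k, n = k + t := ⟨n - t, by omega⟩
  rw [← hj, Nat.add_sub_cancel, schutzenberger_row, schutzenberger_row]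
  exact hX.iterate_promotion.diag_le_diag h1 (by omega) le_rfl

end Promotion

/-- Each of the rows `m + 1, …, n` of `X` is the preceding row with a `1` put in front. -/
def IsOnePadded (m n : ℕ) (X : IntArray) : Prop :=
  ∀ i, m ≤ i → i + 1 ≤ n → X (i + 1) 1 = 1 ∧ ∀ j, 1 ≤ j → j ≤ i → X (i + 1) (j + 1) = X i j

section Padding

variable {m n : ℕ} {X : IntArray}

lemma IsOnePadded.diag_eq (hX : IsOnePadded m n X) (hm : 1 ≤ m) (hmn : m ≤ n) :
    X n n = X m m := by
  induction n, hmn using Nat.le_induction with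
  | base => rfl
  | succ k hmk ih =>
    rw [(hX k hmk le_rfl).2 k (hm.trans hmk) le_rfl]
    exact ih fun i hi hik => hX i hi (by omega)

lemma IsOnePadded.diag_eq_one (hX : IsOnePadded 0 n X) (hn : 1 ≤ n) : X n n = 1 := by
  have hX' : IsOnePadded 1 n X := fun i _ hi => hX i i.zero_le hi
  rw [hX'.diag_eq le_rfl hn, (hX 0 le_rfl hn).1]

/-- Above row `m - 1` the reflected intervals have `X_{i,j}` as their right end, so that the
reflection yields their left end, which is the entry of `∂X` to the lower left, or `1`. -/
protected lemma IsOnePadded.promotion (hpad : IsOnePadded m (n + 1) X)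
    (hX : IsInterlacing (n + 1) X) : IsOnePadded (m - 1) n (promotion X) := by
  intro i hmi hi
  obtain ⟨hone, hshift⟩ := hpad (i + 1) (by omega) (by omega)
  have hlow {j : ℕ} (h1 : 1 ≤ j) (hji : j ≤ i) : X (i + 1) j ≤ promotion X i j :=
    (hX.promotion_bounds h1 hji (by omega)).1.1
  refine ⟨?_, fun j h1 hji => ?_⟩
  · have hshift1 := hshift 1 le_rfl (by omega)
    have hlow1 := hlow (j := 1) le_rfl
    rw [promotion_succ, if_pos (by omega), if_neg (by omega)]
    split_ifs <;> omega
  · have hshift0 := hshift j h1 (by omega)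
    have hshift1 := hshift (j + 1) (by omega) (by omega)
    have hlow0 := hlow h1 hji
    have hlow1 := hlow (j := j + 1) (by omega)
    rw [promotion_succ, if_pos (by omega), if_pos (by omega), Nat.add_sub_cancel]
    split_ifs <;> omega

lemma IsOnePadded.iterate_promotion {t : ℕ} (hpad : IsOnePadded m (n + t) X)
    (hX : IsInterlacing (n + t) X) : IsOnePadded (m - t) n (promotion^[t] X) := by
  induction t generalizing m X with
  | zero => exact hpad
  | succ t ih =>
    rw [Function.iterate_succ_apply, show m - (t + 1) = m - 1 - t by omega]
    exact ih (hpad.promotion hX) hX.promotion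

lemma IsOnePadded.schutzenberger_diag_eq {t j : ℕ} (hpad : IsOnePadded m n X)
    (hX : IsInterlacing n X) (hmn : m ≤ n) (h1 : 1 ≤ j) (hj : j + t = m) :
    schutzenberger n X (n - t) (n - t) = schutzenberger m X j j := by
  obtain ⟨k, rfl⟩ : ∃ k, n = k + t := ⟨n - t, by omega⟩
  subst hj
  have hpad' := hpad.iterate_promotion hX
  rw [Nat.add_sub_cancel] at hpad'
  rw [Nat.add_sub_cancel, schutzenberger_row, schutzenberger_row, hpad'.diag_eq h1 (by omega)]

lemma IsOnePadded.schutzenberger_diag_eq_one {j : ℕ} (hpad : IsOnePadded m n X)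
    (hX : IsInterlacing n X) (h1 : 1 ≤ j) (hj : j + m ≤ n) : schutzenberger n X j j = 1 := by
  obtain ⟨t, rfl⟩ : ∃ t, n = j + t := ⟨n - j, by omega⟩
  have hpad' := hpad.iterate_promotion hX
  rw [Nat.sub_eq_zero_of_le (by omega)] at hpad'
  rw [schutzenberger_row, hpad'.diag_eq_one h1]

lemma IsGelfandTsetlin.isOnePadded_extension (hX : IsGelfandTsetlin m X) :
    IsOnePadded m n (extension n m (fun _ => 1) X) := by
  intro i hmi hi
  refine ⟨?_, fun j h1 hji => ?_⟩
  · rw [extension_apply le_rfl (by omega) hi, show 1 - (i + 1 - m) = 0 by omega,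
      hX.2.1 (min (i + 1) m) 0 (by omega)]
    rfl
  · rw [extension_apply (by omega) (by omega) hi, extension_apply h1 hji (by omega),
      min_eq_right hmi, min_eq_right (by omega), show j + 1 - (i + 1 - m) = j - (i - m) by omega]

end Padding

/-! ### GOGAm pentagons -/

section GOGAm

variable {m n : ℕ} {X : IntArray}

lemma IsGelfandTsetlin.isGOGAm_extension (hX : IsGelfandTsetlin m X) (hmn : m ≤ n)
    (hdiag : ∀ j, 1 ≤ j → j ≤ m → schutzenberger m X j j ≤ (j : ℤ) + (n - m)) :
    IsGOGAm n (extension n m (fun _ => 1) X) := by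
  have hGT : IsGelfandTsetlin n (extension n m (fun _ => 1) X) :=
    hX.extension (fun _ _ => one_pos) monotone_const
  refine ⟨hGT, hGT.schutzenberger, fun j h1 hj => ?_⟩
  rcases Nat.lt_or_ge n (j + m) with hjm | hjm
  · have hrow : ∀ k ≤ m, X k = extension n m (fun _ => 1) X k := fun k hk => by
      rw [← hGT.pentagonPart_row hmn hk, hX.pentagonPart_extension (g := fun _ => 1) hmn hX.1]
    have hj' := hdiag (j + m - n) (by omega) (by omega)
    rw [schutzenberger_congr hrow (by omega),
      ← hX.isOnePadded_extension.schutzenberger_diag_eq (t := n - j) hGT.isInterlacing hmn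
        (by omega) (by omega), Nat.sub_sub_self hj] at hj'
    omega
  · rw [hX.isOnePadded_extension.schutzenberger_diag_eq_one hGT.isInterlacing h1 hjm]
    exact_mod_cast h1

theorem mem_gogamPentagons_iff (hmn : m ≤ n) :
    X ∈ gogamPentagons n m m m ↔
      IsGelfandTsetlin m X ∧ ∀ j, 1 ≤ j → j ≤ m → schutzenberger m X j j ≤ (j : ℤ) + (n - m) := by
  constructor
  · rintro ⟨Y, ⟨hY, -, hdiag⟩, rfl⟩
    refine ⟨hY.pentagonPart hmn, fun j h1 hj => ?_⟩
    rw [schutzenberger_congr (Y := Y) (fun k hk => hY.pentagonPart_row hmn hk) hj]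
    have hle := hY.isInterlacing.schutzenberger_diag_le (t := m - j) hmn h1 (by omega)
    have hmagog := hdiag (n - (m - j)) (by omega) (by omega)
    omega
  · rintro ⟨hX, hdiag⟩
    exact ⟨_, hX.isGOGAm_extension hmn hdiag, hX.pentagonPart_extension hmn hX.1⟩

end GOGAm

/-! ### Triangles of size three -/

section TriangleThree

variable {X : IntArray} {a d f b e c a' d' f' b' e' c' : ℤ}

lemma triangle3_of_outside {i j : ℕ} (hij : ¬(1 ≤ j ∧ j ≤ i ∧ i ≤ 3)) :
    triangle3 a d f b e c i j = 0 := by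
  unfold triangle3
  split <;> first | rfl | exact absurd (by omega) hij

lemma eq_triangle3 (hX : ∀ i j, ¬(1 ≤ j ∧ j ≤ i ∧ i ≤ 3) → X i j = 0) :
    X = triangle3 (X 3 1) (X 3 2) (X 3 3) (X 2 1) (X 2 2) (X 1 1) := by
  funext i j
  by_cases hij : 1 ≤ j ∧ j ≤ i ∧ i ≤ 3
  · obtain ⟨h1, hji, hi⟩ := hij
    interval_cases i <;> interval_cases j <;> rfl
  · rw [hX i j hij, triangle3_of_outside hij]

lemma triangle3_inj :
    triangle3 a d f b e c = triangle3 a' d' f' b' e' c' ↔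
      a = a' ∧ d = d' ∧ f = f' ∧ b = b' ∧ e = e' ∧ c = c' := by
  refine ⟨fun h => ?_, ?_⟩
  · exact ⟨congr_fun₂ h 3 1, congr_fun₂ h 3 2, congr_fun₂ h 3 3, congr_fun₂ h 2 1,
      congr_fun₂ h 2 2, congr_fun₂ h 1 1⟩
  · rintro ⟨rfl, rfl, rfl, rfl, rfl, rfl⟩
    rfl

lemma isGelfandTsetlin_triangle3 :
    IsGelfandTsetlin 3 (triangle3 a d f b e c) ↔
      0 < a ∧ a ≤ b ∧ b ≤ c ∧ c ≤ e ∧ b ≤ d ∧ d ≤ e ∧ e ≤ f := by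
  constructor
  · rintro ⟨hpos, -, hrows⟩
    obtain ⟨hab, hbd⟩ := hrows 2 1 (by omega) (by omega) (by omega)
    obtain ⟨hde, hef⟩ := hrows 2 2 (by omega) (by omega) (by omega)
    obtain ⟨hbc, hce⟩ := hrows 1 1 (by omega) (by omega) (by omega)
    exact ⟨hpos 3 1 (by omega) (by omega) (by omega), hab, hbc, hce, hbd, hde, hef⟩
  · rintro ⟨ha, hab, hbc, hce, hbd, hde, hef⟩
    refine ⟨fun i j h1 hji hi => ?_, fun i j hij => triangle3_of_outside hij,
      fun i j h1 hji hi => ?_⟩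
    · interval_cases i <;> interval_cases j <;> simp only [triangle3] <;> omega
    · replace hi : i ≤ 2 := by omega
      interval_cases i <;> interval_cases j <;> simp only [triangle3] <;> omega

end TriangleThree

section PentagonsThree

variable {n : ℕ} {X : IntArray} {a d f b e c : ℤ}

lemma isMonotoneTriangle_three_iff :
    IsMonotoneTriangle 3 X ↔
      IsGelfandTsetlin 3 X ∧ X 3 1 < X 3 2 ∧ X 3 2 < X 3 3 ∧ X 2 1 < X 2 2 := by
  refine and_congr_right fun _ => ⟨fun h => ?_, ?_⟩
  · exact ⟨h 3 1 (by omega) (by omega) (by omega), h 3 2 (by omega) (by omega) (by omega),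
      h 2 1 (by omega) (by omega) (by omega)⟩
  · rintro ⟨had, hdf, hbe⟩ i j h1 hji hi
    obtain ⟨rfl, rfl⟩ | ⟨rfl, rfl⟩ | ⟨rfl, rfl⟩ :
        (i = 3 ∧ j = 1) ∨ (i = 3 ∧ j = 2) ∨ (i = 2 ∧ j = 1) := by omega
    exacts [had, hdf, hbe]

lemma mem_gogPentagons_three_iff (hn : 3 ≤ n) :
    X ∈ gogPentagons n 3 3 3 ↔
      IsGelfandTsetlin 3 X ∧ X 3 1 < X 3 2 ∧ X 3 2 < X 3 3 ∧ X 2 1 < X 2 2 ∧ X 3 3 ≤ (n : ℤ) := by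
  simp only [mem_gogPentagons_iff (by omega) hn, isMonotoneTriangle_three_iff, and_assoc]

lemma promotion_one_one (X : IntArray) : promotion X 1 1 = X 2 1 + X 2 2 - X 1 1 := by
  simp [promotion_succ]

lemma promotion_two_one (X : IntArray) :
    promotion X 2 1 = X 3 1 + min (X 3 2) (X 2 1 + X 2 2 - X 1 1) - X 2 1 := by
  simp [promotion_succ X 1, promotion_one_one]

lemma promotion_two_two (X : IntArray) :
    promotion X 2 2 = max (X 3 2) (X 2 1 + X 2 2 - X 1 1) + X 3 3 - X 2 2 := by
  simp [promotion_succ X 1, promotion_one_one]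

lemma schutzenberger_three_one_one (X : IntArray) :
    schutzenberger 3 X 1 1 = X 3 3 - X 2 2 + X 3 2 - X 2 1 + X 3 1 := by
  have h : schutzenberger 3 X 1 1 = promotion (promotion X) 1 1 :=
    congr_fun (schutzenberger_row 1 2 X) 1
  rw [h, promotion_one_one, promotion_two_one, promotion_two_two, promotion_one_one]
  omega

lemma schutzenberger_three_two_two (X : IntArray) :
    schutzenberger 3 X 2 2 = max (X 3 2) (X 2 1 + X 2 2 - X 1 1) + X 3 3 - X 2 2 := by
  rw [← promotion_two_two]
  exact congr_fun (schutzenberger_row 2 1 X) 2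

lemma mem_gogamPentagons_three_iff (hn : 3 ≤ n) :
    X ∈ gogamPentagons n 3 3 3 ↔
      IsGelfandTsetlin 3 X ∧ X 3 3 ≤ (n : ℤ) ∧
        X 3 3 - X 2 2 + X 3 2 ≤ (n : ℤ) - 1 ∧ X 3 3 - X 1 1 + X 2 1 ≤ (n : ℤ) - 1 ∧
        X 3 3 - X 2 2 + X 3 2 - X 2 1 + X 3 1 ≤ (n : ℤ) - 2 := by
  have hdiag₁ := schutzenberger_three_one_one X
  have hdiag₂ := schutzenberger_three_two_two X
  have hdiag₃ : schutzenberger 3 X 3 3 = X 3 3 := congr_fun (schutzenberger_of_le le_rfl X) 3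
  rw [mem_gogamPentagons_iff hn]
  refine and_congr_right fun _ => ⟨fun h => ?_, fun h j h1 hj => ?_⟩
  · have h₁ := h 1 (by omega) (by omega)
    have h₂ := h 2 (by omega) (by omega)
    have h₃ := h 3 (by omega) (by omega)
    omega
  · interval_cases j <;> omega

lemma triangle3_mem_gogPentagons_iff (hn : 3 ≤ n) :
    triangle3 a d f b e c ∈ gogPentagons n 3 3 3 ↔
      (0 < a ∧ a ≤ b ∧ b ≤ c ∧ c ≤ e ∧ b ≤ d ∧ d ≤ e ∧ e ≤ f) ∧
        a < d ∧ d < f ∧ b < e ∧ f ≤ n := by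
  rw [mem_gogPentagons_three_iff hn, isGelfandTsetlin_triangle3]
  rfl

lemma triangle3_mem_gogamPentagons_iff (hn : 3 ≤ n) :
    triangle3 a d f b e c ∈ gogamPentagons n 3 3 3 ↔
      (0 < a ∧ a ≤ b ∧ b ≤ c ∧ c ≤ e ∧ b ≤ d ∧ d ≤ e ∧ e ≤ f) ∧
        f ≤ n ∧ f - e + d ≤ n - 1 ∧ f - c + b ≤ n - 1 ∧ f - e + d - b + a ≤ n - 2 := by
  rw [mem_gogamPentagons_three_iff hn, isGelfandTsetlin_triangle3]
  rfl

lemma exists_triangle3_of_mem_gogPentagons (hn : 3 ≤ n) (hX : X ∈ gogPentagons n 3 3 3) :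
    ∃ a d f b e c, X = triangle3 a d f b e c :=
  ⟨_, _, _, _, _, _, eq_triangle3 ((mem_gogPentagons_three_iff hn).1 hX).1.2.1⟩

lemma exists_triangle3_of_mem_gogamPentagons (hn : 3 ≤ n) (hX : X ∈ gogamPentagons n 3 3 3) :
    ∃ a d f b e c, X = triangle3 a d f b e c :=
  ⟨_, _, _, _, _, _, eq_triangle3 ((mem_gogamPentagons_three_iff hn).1 hX).1.2.1⟩

end PentagonsThree

/-! ### The table -/

section Table

variable {n : ℕ} {a d f b e c : ℤ}

lemma isInversion_triangle3_two_one : IsInversion 3 (triangle3 a d f b e c) 2 1 ↔ b = a :=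
  and_iff_right (by omega)

lemma isInversion_triangle3_two_two : IsInversion 3 (triangle3 a d f b e c) 2 2 ↔ e = d :=
  and_iff_right (by omega)

lemma isInversion_triangle3_one_one : IsInversion 3 (triangle3 a d f b e c) 1 1 ↔ c = b :=
  and_iff_right (by omega)

lemma pentagonTable_triangle3 (a d f b e c : ℤ) :
    pentagonTable (triangle3 a d f b e c) =
      if b = a then
        if e = d then
          if c = b then triangle3 a (d - 1) (f - 2) a (d - 1) a
          else triangle3 a (d - 1) (f - 1) a d c
        else if c = b then triangle3 a (d - 1) (f - 1) a (e - 1) a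
        else triangle3 a (d - 1) f a e c
      else if e = d then
        if c = b then triangle3 a (d - 1) (f - 2) a (d - 1) b
        else triangle3 a d (f - 1) b d c
      else if c = b then triangle3 a d (f - 1) b (e - 1) b
      else triangle3 a d f b e c := by
  simp only [pentagonTable, isInversion_triangle3_two_one, isInversion_triangle3_two_two,
    isInversion_triangle3_one_one]
  split_ifs <;> subst_vars <;> simp only [*, decide_true, decide_false] <;> rfl

/-- The inverse of `pentagonTable` on GOGAm pentagons, with the entries of the GOGAm pentagon named
as in `triangle3`. The preimage has the exceptional inversions `(1,1), (2,2)` if `b = a`, `e = d`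
and `c ≠ b`. -/
def pentagonTableInv (X : IntArray) : IntArray :=
  let a := X 3 1
  let d := X 3 2
  let f := X 3 3
  let b := X 2 1
  let e := X 2 2
  let c := X 1 1
  if b = a then
    if c = b then
      if e = d then triangle3 a (d + 1) (f + 2) a (d + 1) a
      else triangle3 a (d + 1) (f + 1) a (e + 1) a
    else if e = d then triangle3 a (d + 1) (f + 2) c (d + 1) c
    else if e = d + 1 then triangle3 a (d + 1) (f + 1) a (d + 1) c
    else triangle3 a (d + 1) f a e c
  else if c = b then triangle3 a d (f + 1) b (e + 1) b
  else if e = d then triangle3 a d (f + 1) b d c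
  else triangle3 a d f b e c

lemma mapsTo_pentagonTable (hn : 3 ≤ n) :
    Set.MapsTo pentagonTable (gogPentagons n 3 3 3) (gogamPentagons n 3 3 3) := by
  intro X hX
  obtain ⟨a, d, f, b, e, c, rfl⟩ := exists_triangle3_of_mem_gogPentagons hn hX
  rw [triangle3_mem_gogPentagons_iff hn] at hX
  rw [pentagonTable_triangle3]
  split_ifs <;> rw [triangle3_mem_gogamPentagons_iff hn] <;> omega

lemma mapsTo_pentagonTableInv (hn : 3 ≤ n) :
    Set.MapsTo pentagonTableInv (gogamPentagons n 3 3 3) (gogPentagons n 3 3 3) := by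
  intro X hX
  obtain ⟨a, d, f, b, e, c, rfl⟩ := exists_triangle3_of_mem_gogamPentagons hn hX
  rw [triangle3_mem_gogamPentagons_iff hn] at hX
  simp only [pentagonTableInv, triangle3]
  split_ifs <;> rw [triangle3_mem_gogPentagons_iff hn] <;> omega

lemma leftInvOn_pentagonTableInv (hn : 3 ≤ n) :
    Set.LeftInvOn pentagonTableInv pentagonTable (gogPentagons n 3 3 3) := by
  intro X hX
  obtain ⟨a, d, f, b, e, c, rfl⟩ := exists_triangle3_of_mem_gogPentagons hn hX
  rw [triangle3_mem_gogPentagons_iff hn] at hX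
  rw [pentagonTable_triangle3]
  split_ifs <;> simp only [pentagonTableInv, triangle3] <;> split_ifs <;>
    rw [triangle3_inj] <;> omega

lemma rightInvOn_pentagonTableInv (hn : 3 ≤ n) :
    Set.RightInvOn pentagonTableInv pentagonTable (gogamPentagons n 3 3 3) := by
  intro X hX
  obtain ⟨a, d, f, b, e, c, rfl⟩ := exists_triangle3_of_mem_gogamPentagons hn hX
  rw [triangle3_mem_gogamPentagons_iff hn] at hX
  simp only [pentagonTableInv, triangle3]
  split_ifs <;> rw [pentagonTable_triangle3] <;> split_ifs <;> rw [triangle3_inj] <;> omega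

theorem bijOn_pentagonTable (hn : 3 ≤ n) :
    Set.BijOn pentagonTable (gogPentagons n 3 3 3) (gogamPentagons n 3 3 3) :=
  Set.InvOn.bijOn ⟨leftInvOn_pentagonTableInv hn, rightInvOn_pentagonTableInv hn⟩
    (mapsTo_pentagonTable hn) (mapsTo_pentagonTableInv hn)

end Table

/-! ### The standard procedure -/

section StandardProcedure

variable {n : ℕ} {a d f b e c : ℤ}

lemma covers_iff {p q : ℕ × ℕ} :
    Covers n p q ↔ p.1 < q.1 ∧ q.1 ≤ n ∧ q.1 + p.2 = p.1 + q.2 := by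
  constructor
  · rintro ⟨t, ht, hn, rfl⟩
    exact ⟨by omega, hn, by omega⟩
  · rintro ⟨hlt, hn, hdiag⟩
    exact ⟨q.1 - p.1, by omega, by omega, Prod.ext (by omega) (by omega)⟩

lemma subtractCovered_apply (X : IntArray) (p : ℕ × ℕ) (i j : ℕ) :
    subtractCovered n X p i j =
      if p.1 < i ∧ i ≤ n ∧ i + p.2 = p.1 + j then X i j - 1 else X i j := by
  simp only [subtractCovered, covers_iff]

lemma subtractCovered_triangle3 (a d f b e c : ℤ) {p : ℕ × ℕ} (h1 : 1 ≤ p.2) (hp : p.2 ≤ p.1) :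
    subtractCovered 3 (triangle3 a d f b e c) p =
      triangle3 a (if p.1 < 3 ∧ p.1 = p.2 + 1 then d - 1 else d)
        (if p.1 < 3 ∧ p.1 = p.2 then f - 1 else f) b
        (if p.1 < 2 ∧ p.1 = p.2 then e - 1 else e) c := by
  refine (eq_triangle3 fun i j hij => ?_).trans (triangle3_inj.2 ?_)
  · rw [subtractCovered_apply, if_neg (by omega), triangle3_of_outside hij]
  · simp only [subtractCovered_apply]
    exact ⟨if_neg (by omega), if_congr (by omega) rfl rfl, if_congr (by omega) rfl rfl,
      if_neg (by omega), if_congr (by omega) rfl rfl, if_neg (by omega)⟩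

lemma subtractCovered_two_two (a d f b e c : ℤ) :
    subtractCovered 3 (triangle3 a d f b e c) (2, 2) = triangle3 a d (f - 1) b e c := by
  simp [subtractCovered_triangle3]

lemma subtractCovered_two_one (a d f b e c : ℤ) :
    subtractCovered 3 (triangle3 a d f b e c) (2, 1) = triangle3 a (d - 1) f b e c := by
  simp [subtractCovered_triangle3]

lemma subtractCovered_one_one (a d f b e c : ℤ) :
    subtractCovered 3 (triangle3 a d f b e c) (1, 1) = triangle3 a d (f - 1) b (e - 1) c := by
  simp [subtractCovered_triangle3]

lemma inversionList_triangle3 (a d f b e c : ℤ) :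
    inversionList 3 (triangle3 a d f b e c) =
      (if e = d then [(2, 2)] else []) ++ (if b = a then [(2, 1)] else []) ++
        (if c = b then [(1, 1)] else []) := by
  have hpos :
      ((List.range 3).reverse.flatMap fun j => (List.range 3).reverse.map fun i => (i, j)) =
        [(2, 2), (1, 2), (0, 2), (2, 1), (1, 1), (0, 1), (2, 0), (1, 0), (0, 0)] := rfl
  have hzero (i : ℕ) : ¬IsInversion 3 (triangle3 a d f b e c) i 0 :=
    fun h => absurd h.1.1 (by omega)
  have hlt {i j : ℕ} (hij : i < j) : ¬IsInversion 3 (triangle3 a d f b e c) i j :=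
    fun h => hij.not_ge h.1.2.1
  simp only [inversionList, hpos, List.filter_cons, List.filter_nil, isInversion_triangle3_two_one,
    isInversion_triangle3_two_two, isInversion_triangle3_one_one, hzero, hlt one_lt_two,
    hlt two_pos, hlt one_pos, decide_eq_true_eq, if_false]
  split_ifs <;> rfl

lemma standardProcedure_triangle3 {n : ℕ} (hn : 3 ≤ n)
    (hX : triangle3 a d f b e c ∈ gogPentagons n 3 3 3) (h : ¬(c = b ∧ e = d ∧ ¬b = a)) :
    Admissible 3 (triangle3 a d f b e c) ∧
      pentagonTable (triangle3 a d f b e c) = standardProcedure 3 (triangle3 a d f b e c) := by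
  rw [triangle3_mem_gogPentagons_iff hn] at hX
  rw [Admissible, standardProcedure, pentagonTable_triangle3, inversionList_triangle3]
  split_ifs <;>
    simp only [List.nil_append, List.append_nil, List.cons_append, List.scanl_cons,
      List.scanl_nil, List.foldl_cons, List.foldl_nil, List.forall_mem_cons, List.not_mem_nil,
      false_implies, implies_true, subtractCovered_two_two, subtractCovered_two_one,
      subtractCovered_one_one, isGelfandTsetlin_triangle3, triangle3_inj, and_true, true_and] <;>
    omega

lemma not_admissible_triangle3 (hb : b ≠ a) : ¬Admissible 3 (triangle3 a d f b d b) := by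
  rw [Admissible, inversionList_triangle3, if_pos rfl, if_pos rfl, if_neg hb]
  simp only [List.nil_append, List.append_nil, List.cons_append, List.scanl_cons,
    List.scanl_nil, List.forall_mem_cons, List.not_mem_nil, false_implies, implies_true,
    subtractCovered_two_two, subtractCovered_one_one, isGelfandTsetlin_triangle3]
  omega

end StandardProcedure

end Pentagons

theorem mainTheorem4 (n : ℕ) (hn : 3 ≤ n) :
    -- the `(n,3,3,3)` Gog pentagons
    (∀ X : IntArray, X ∈ gogPentagons n 3 3 3 ↔
      IsGelfandTsetlin 3 X ∧
        X 3 1 < X 3 2 ∧ X 3 2 < X 3 3 ∧ X 2 1 < X 2 2 ∧ X 3 3 ≤ (n : ℤ)) ∧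
    -- the `(n,3,3,3)` GOGAm pentagons
    (∀ X : IntArray, X ∈ gogamPentagons n 3 3 3 ↔
      IsGelfandTsetlin 3 X ∧
        X 3 3 ≤ (n : ℤ) ∧
        X 3 3 - X 2 2 + X 3 2 ≤ (n : ℤ) - 1 ∧
        X 3 3 - X 1 1 + X 2 1 ≤ (n : ℤ) - 1 ∧
        X 3 3 - X 2 2 + X 3 2 - X 2 1 + X 3 1 ≤ (n : ℤ) - 2) ∧
    -- the table is a bijection
    Set.BijOn pentagonTable (gogPentagons n 3 3 3) (gogamPentagons n 3 3 3) ∧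
    -- it is the standard procedure in seven cases, and in the remaining one that does not apply
    (∀ X ∈ gogPentagons n 3 3 3,
      (¬ (IsInversion 3 X 1 1 ∧ IsInversion 3 X 2 2 ∧ ¬ IsInversion 3 X 2 1) →
        Admissible 3 X ∧ pentagonTable X = standardProcedure 3 X) ∧
      (IsInversion 3 X 1 1 ∧ IsInversion 3 X 2 2 ∧ ¬ IsInversion 3 X 2 1 →
        ¬ Admissible 3 X)) ∧
    -- the pentagon conjecture for this shape
    (gogPentagons n 3 3 3).Finite ∧ (gogamPentagons n 3 3 3).Finite ∧
    (gogPentagons n 3 3 3).ncard = (gogamPentagons n 3 3 3).ncard := by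
  have hbij := bijOn_pentagonTable hn
  have hfin := finite_gogPentagons n 3 3 3
  refine ⟨fun X => mem_gogPentagons_three_iff hn, fun X => mem_gogamPentagons_three_iff hn, hbij,
    fun X hX => ?_, hfin, hbij.image_eq ▸ hfin.image _, ?_⟩
  · obtain ⟨a, d, f, b, e, c, rfl⟩ := exists_triangle3_of_mem_gogPentagons hn hX
    rw [isInversion_triangle3_one_one, isInversion_triangle3_two_two, isInversion_triangle3_two_one]
    refine ⟨standardProcedure_triangle3 hn hX, ?_⟩
    rintro ⟨rfl, rfl, hb⟩
    exact not_admissible_triangle3 hb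
  · rw [← hbij.image_eq, hbij.injOn.ncard_image]
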